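/- Let $t\ge 1$ be an integer. For a partition $\mu$ let $\mu'$ denote its conjugate, and call $\mu$ self-conjugate if $\mu=\mu'$. Throughout, the rows of a two-rowed array are strictly decreasing finite sequences of nonnegative integers, not necessarily of the same length. **The decomposition.** Let $\lambda$ be a partition, let $s$ be the side length of its Durfee square, and let $\mathfrak F(\lambda)=\begin{pmatrix}a_1&\cdots&a_s\\ b_1&\cdots&b_s\end{pmatrix}$ with $a_i=\lambda_i-i$, $b_i=\lambda'_i-i$ be its Frobenius partition. Write $a_i=tq_i+r_i$ and $b_i=tq_i'+(t-r_i'-1)$ with $q_i,q_i'\ge 0$ and $0\le r_i,r'_i\le t-1$. For $0\le j\le t-1$ let $\mathfrak C_j$ be the two-rowed array whose top row consists of the $q_i$ with $r_i=j$ and whose bottom row consists of the $q'_i$ with $r'_i=j$; let $u_j$ and $v_j$ be the lengths of its top and bottom rows. * The $t$-core $\lambda^{(t)}$ is the partition whose Frobenius partition has top row consisting of the numbers $tk+j$ with $0\le j\le t-1$, $0\le k<u_j-v_j$, and bottom row consisting of the numbers $tk+(t-j-1)$ with $0\le j\le t-1$, $0\le k<v_j-u_j$. * The component $\lambda_{(j)}$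 of the $t$-quotient $(\lambda_{(0)},\dots,\lambda_{(t-1)})$ is obtained from $\mathfrak C_j=\begin{pmatrix}\alpha_1&\cdots&\alpha_u\\ \beta_1&\cdots&\beta_v\end{pmatrix}$ (with $u=u_j$, $v=v_j$) by Wright's map: its first $u$ parts are $\alpha_i+i-(u-v)$, $1\le i\le u$, and its remaining parts form the conjugate of the partition $(\beta_1-v+1,\beta_2-v+2,\dots,\beta_v)$ (zero parts are ignored). **The abacus form.** For a multiple $N$ of $t$ that is at least the number of parts of $\lambda$, let $X=\{\lambda_i+N-i:1\le i\le N\}$ (with $\lambda_i=0$ beyond the last part), and let $X_j=\{q\ge 0: tq+j\in X\}$ for $0\le j\le t-1$. For a finite set $Y$ of nonnegative integers, the partition with beta-set $Y$ is the one with parts $\#\{z<y: z\ge 0,\ z\notin Y\}$, $y\in Y$ (zero parts are ignored). In the abacus form, the component $\lambda_{(j)}$ of the $t$-quotient is the partition with beta-set $X_j$, and the $t$-core $\lambda^{(t)}$ is the partition with beta-set $\{tq+j:0\le j\le t-1,\ 0\le q<\#X_j\}$. **Proposition.** If $\lambda$ is self-conjugate, then its $t$-core $\lambda^{(t)}$ is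 self-conjugate, and its $t$-quotient satisfies $$\lambda_{(j)}'=\lambda_{(t-j-1)}\qquad\text{for } j=0,1,\dots,t-1.$$ This holds for the $t$-core and $t$-quotient defined through Frobenius partitions, and for those defined through the abacus with any number $N$ of beads as above. -/

import Mathlib

/-! A partition is identified with its Young diagram (`YoungDiagram`, rows and columns counted
from `0`); the conjugate of `μ` is `μ.transpose`. -/

namespace Littlewood

/-- A two-rowed array with entries in `α`. Each row is a strictly decreasing sequence and is stored
as the finite set of its entries; the two rows may have different lengths. -/
structure TwoRowedArray (α : Type) where
  top : Finset α
  bottom : Finset α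

/-- The partition with the given multiset of parts (zero parts are allowed and ignored). -/
def ofParts (s : Multiset ℕ) : YoungDiagram :=
  YoungDiagram.ofRowLens (s.sort (· ≥ ·)) (s.pairwise_sort (· ≥ ·)).sortedGE

/-- The side length of the Durfee square, i.e. the number of boxes on the main diagonal. -/
def durfee (μ : YoungDiagram) : ℕ :=
  (μ.cells.filter fun c => c.1 = c.2).card

/-- The Frobenius partition of `μ`: for `i = 1, …, s`, where `s` is the side length of the Durfee
square, the top row has the entries `μ_i - i` and the bottom row the entries `μ'_i - i`. -/
def frobenius (μ : YoungDiagram) : TwoRowedArray ℕ where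
  top := (Finset.range (durfee μ)).image fun i => μ.rowLen i - (i + 1)
  bottom := (Finset.range (durfee μ)).image fun i => μ.colLen i - (i + 1)

/-- The position `i = 1, 2, …` of an entry `a = a_i` in the strictly decreasing row `A`. -/
def position (A : Finset ℕ) (a : ℕ) : ℕ :=
  (A.filter fun y => a ≤ y).card

/-- The partition `μ` in Wright's map `(a_1 … a_u ; b_1 … b_v) ↦ (Δ, μ)`:
`μ_i = a_i + i - (u - v)` for `i ≤ u`, and `(μ_{u+1}, μ_{u+2}, …)` is the conjugate of the
partition `ν = (b_1 - v + 1, b_2 - v + 2, …, b_v)`. No subtraction here truncates, because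
`a_i ≥ u - i` and `b_i ≥ v - i`. -/
def wright (A : TwoRowedArray ℕ) : YoungDiagram :=
  let u := A.top.card
  let v := A.bottom.card
  let ν := ofParts (A.bottom.val.map fun b => b + position A.bottom b - v)
  ofParts ((A.top.val.map fun a => a + position A.top a + v - u)
    + (ν.transpose.rowLens : Multiset ℕ))

/-- The partition with a given Frobenius partition (two rows of the same length `s`). It has the
parts `a_i + i` for `i ≤ s`, and below the Durfee square it has the conjugate of the partition with
parts `b_i + i - s`. -/
def ofFrobenius (A : TwoRowedArray ℕ) : YoungDiagram :=
  let s := A.top.card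
  let ν := ofParts (A.bottom.val.map fun b => b + position A.bottom b - s)
  ofParts ((A.top.val.map fun a => a + position A.top a) + (ν.transpose.rowLens : Multiset ℕ))

/-- The `t`-colored Frobenius partition of `μ`. The pair `(q, r)` stands for the integer `q` with
color `r`: a top entry `a = t q + r` becomes `(q, r)`, and a bottom entry `b = t q + (t - r - 1)`
becomes `(q, r)`. -/
def coloredFrobenius (t : ℕ) (μ : YoungDiagram) : TwoRowedArray (ℕ × ℕ) where
  top := (frobenius μ).top.image fun a => (a / t, a % t)
  bottom := (frobenius μ).bottom.image fun b => (b / t, t - b % t - 1)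

/-- The inverse passage from `t`-colored entries to ordinary entries. -/
def uncolor (t : ℕ) (A : TwoRowedArray (ℕ × ℕ)) : TwoRowedArray ℕ where
  top := A.top.image fun c => t * c.1 + c.2
  bottom := A.bottom.image fun c => t * c.1 + (t - c.2 - 1)

/-- The array of the entries of color `j` in the `t`-colored Frobenius partition of `μ`, with the
color dropped. -/
def colorClass (t : ℕ) (μ : YoungDiagram) (j : ℕ) : TwoRowedArray ℕ where
  top := ((coloredFrobenius t μ).top.filter fun c => c.2 = j).image Prod.fst
  bottom := ((coloredFrobenius t μ).bottom.filter fun c => c.2 = j).image Prod.fst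

/-- The `t`-colored Frobenius partition of the `t`-core. With `w_j = u_j - v_j` (row lengths of the
array of color `j`), the top row has the entries `0_j, …, (w_j - 1)_j` for every `j` with `w_j > 0`,
and the bottom row has the entries `0_j, …, (-w_j - 1)_j` for every `j` with `w_j < 0`. (Truncated
subtraction gives no entries in the other cases.) -/
def coreColored (t : ℕ) (μ : YoungDiagram) : TwoRowedArray (ℕ × ℕ) where
  top := (Finset.range t).biUnion fun j =>
    (Finset.range ((colorClass t μ j).top.card - (colorClass t μ j).bottom.card)).image
      fun k => (k, j)
  bottom := (Finset.range t).biUnion fun j =>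
    (Finset.range ((colorClass t μ j).bottom.card - (colorClass t μ j).top.card)).image
      fun k => (k, j)

/-- The `t`-core of `μ`, from Frobenius partitions. -/
def core (t : ℕ) (μ : YoungDiagram) : YoungDiagram :=
  ofFrobenius (uncolor t (coreColored t μ))

/-- The `j`-th component (`0 ≤ j < t`) of the `t`-quotient of `μ`, from Frobenius partitions. -/
def quotient (t : ℕ) (μ : YoungDiagram) (j : ℕ) : YoungDiagram :=
  wright (colorClass t μ j)

/-! The same decomposition read off from the `t`-abacus. -/

/-- The beta-set of `μ` with `N` beads, `{μ_i + N - i : 1 ≤ i ≤ N}`; `N` is at least the number of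
parts of `μ`. -/
def betaSet (μ : YoungDiagram) (N : ℕ) : Finset ℕ :=
  (Finset.range N).image fun i => μ.rowLen i + (N - (i + 1))

/-- The partition with beta-set `X`: each bead `x ∈ X` gives the part `#{y < x : y ∉ X}`. -/
def ofBetaSet (X : Finset ℕ) : YoungDiagram :=
  ofParts (X.val.map fun x => ((Finset.range x).filter fun y => y ∉ X).card)

/-- The set of positions of the beads on runner `j` of the `t`-abacus: the bead `t q + j` is at
position `q` of runner `j`. -/
def runner (t : ℕ) (X : Finset ℕ) (j : ℕ) : Finset ℕ :=
  (X.filter fun x => x % t = j).image fun x => x / t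

/-- The `t`-core from the abacus with `N` beads: push all beads up on their runners. -/
def abacusCore (t N : ℕ) (μ : YoungDiagram) : YoungDiagram :=
  ofBetaSet ((Finset.range t).biUnion fun j =>
    (Finset.range (runner t (betaSet μ N) j).card).image fun q => t * q + j)

/-- The `j`-th component of the `t`-quotient from the abacus with `N` beads: the partition whose
beta-set is runner `j`. -/
def abacusQuotient (t N : ℕ) (μ : YoungDiagram) (j : ℕ) : YoungDiagram :=
  ofBetaSet (runner t (betaSet μ N) j)

end Littlewood

namespace Littlewood

/-! Conjugation is a visible symmetry of both encodings. Frobenius form: by `mem_wright`, Wright's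
map builds a u × v rectangle with the partition of beta-set `top` to its right and the conjugate of
the partition of beta-set `bottom` below it, so swapping the rows conjugates (`transpose_wright`). A
self-conjugate partition has equal Frobenius rows, and the residue conventions then make color t - j
- 1 the color j with rows swapped. Abacus form: exchanging beads with gaps and reversing a window
conjugates (`transpose_ofBetaSet`). The beta-set of a self-conjugate partition is fixed by this
operation on {0, …, 2N - 1} (`mem_betaSet_iff_reflect`). As t ∣ N, the reflection carries runner j
to runner t - j - 1 reversed; the bead counts of the two runners add up to 2N/t, which settles the
core. -/

/-! ### Boxes of a partition given by its parts -/

/-- In a weakly decreasing list the entries exceeding `j` form an initial segment. -/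
theorem lt_countP_iff_of_pairwise_ge {l : List ℕ} (hl : l.Pairwise (· ≥ ·)) (i j : ℕ) :
    i < l.countP (fun p => decide (j < p)) ↔ ∃ h : i < l.length, j < l[i] := by
  induction l generalizing i with
  | nil => simp
  | cons a l ih =>
    rw [List.pairwise_cons] at hl
    by_cases ha : j < a
    · rw [List.countP_cons_of_pos (by simpa using ha)]
      cases i with
      | zero => simpa using ha
      | succ i => simpa using ih hl.2 i
    · have h0 : (a :: l).countP (fun p => decide (j < p)) = 0 := by
        rw [List.countP_eq_zero]
        intro b hb
        rcases List.mem_cons.1 hb with rfl | hb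
        · simpa using ha
        · have := hl.1 b hb
          simp only [decide_eq_true_eq]
          omega
      rw [h0]
      constructor
      · intro h; omega
      · rintro ⟨h, hj⟩
        cases i with
        | zero => exact absurd hj ha
        | succ i =>
          have hi : i < l.length := by simpa using h
          have := hl.1 _ (List.getElem_mem hi)
          simp only [List.getElem_cons_succ] at hj
          omega

theorem mem_ofParts {s : Multiset ℕ} {i j : ℕ} :
    (i, j) ∈ ofParts s ↔ i < s.countP (fun p => j < p) := by
  rw [ofParts, YoungDiagram.mem_ofRowLens, ← lt_countP_iff_of_pairwise_ge (s.pairwise_sort _),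
    ← Multiset.coe_countP, Multiset.sort_eq]

theorem countP_rowLens (μ : YoungDiagram) (j : ℕ) :
    (μ.rowLens : Multiset ℕ).countP (fun p => j < p) = μ.colLen j := by
  refine eq_of_forall_lt_iff fun i => ?_
  rw [Multiset.coe_countP, lt_countP_iff_of_pairwise_ge μ.rowLens_sorted.pairwise,
    ← YoungDiagram.mem_iff_lt_colLen]
  conv_rhs => rw [← μ.ofRowLens_to_rowLens_eq_self]
  rw [YoungDiagram.mem_ofRowLens]

/-! ### Beads, gaps and conjugation of beta-sets -/

theorem card_gaps (X : Finset ℕ) (x : ℕ) :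
    ((Finset.range x).filter fun y => y ∉ X).card + (X.filter fun y => y < x).card = x := by
  have h := Finset.card_filter_add_card_filter_not (s := Finset.range x) (fun y => y ∈ X)
  have e : (Finset.range x).filter (fun y => y ∈ X) = X.filter fun y => y < x := by
    ext y; simp [and_comm]
  rw [e, Finset.card_range] at h
  omega

/-- For a bead `x = α_i` this identifies Wright's α_i + i - u with the number of gaps below it. -/
theorem card_gaps_add_card (X : Finset ℕ) (x : ℕ) :
    ((Finset.range x).filter fun y => y ∉ X).card + X.card = x + position X x := by
  have h := Finset.card_filter_add_card_filter_not (s := X) (fun y => y < x)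
  have := card_gaps X x
  simp only [not_lt] at h
  rw [position]
  omega

theorem mem_ofBetaSet {X : Finset ℕ} {i j : ℕ} :
    (i, j) ∈ ofBetaSet X ↔
      i < (X.filter fun x => j < ((Finset.range x).filter fun y => y ∉ X).card).card := by
  rw [ofBetaSet, mem_ofParts, Multiset.countP_map, Finset.card, Finset.filter_val]

theorem lt_card_of_mem_ofBetaSet {X : Finset ℕ} {i j : ℕ} (h : (i, j) ∈ ofBetaSet X) :
    i < X.card :=
  (mem_ofBetaSet.1 h).trans_le (Finset.card_filter_le _ _)

/-- A cut at `n` with beads above and gaps below treats rows and columns alike, so conjugation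
becomes the exchange of beads and gaps. -/
theorem mem_ofBetaSet_iff_exists {X : Finset ℕ} {i j : ℕ} :
    (i, j) ∈ ofBetaSet X ↔ ∃ n, i < (X.filter fun x => n ≤ x).card ∧
      j < ((Finset.range n).filter fun y => y ∉ X).card := by
  have mono : ∀ {m n : ℕ}, m ≤ n → ((Finset.range m).filter fun y => y ∉ X).card ≤
      ((Finset.range n).filter fun y => y ∉ X).card := fun h =>
    Finset.card_le_card (Finset.filter_subset_filter _ (Finset.range_mono h))
  rw [mem_ofBetaSet]
  constructor
  · intro h
    set T := X.filter fun x => j < ((Finset.range x).filter fun y => y ∉ X).card with hT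
    have hne : T.Nonempty := Finset.card_pos.1 (by omega)
    -- The cut is placed at the lowest bead with more than `j` gaps below it.
    refine ⟨T.min' hne, h.trans_le (Finset.card_le_card fun x hx => ?_), ?_⟩
    · exact Finset.mem_filter.2 ⟨(Finset.mem_filter.1 hx).1, T.min'_le x hx⟩
    · exact (Finset.mem_filter.1 (T.min'_mem hne)).2
  · rintro ⟨n, hi, hj⟩
    refine hi.trans_le (Finset.card_le_card fun x hx => ?_)
    rw [Finset.mem_filter] at hx ⊢
    exact ⟨hx.1, hj.trans_le (mono hx.2)⟩

/-- If `Y` is the reflection of the complement of `X` in `{0, …, M - 1}`, then `Y` is a beta-set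
of the conjugate partition. -/
theorem transpose_ofBetaSet {X Y : Finset ℕ} {M : ℕ} (hX : ∀ x ∈ X, x < M) (hY : ∀ y ∈ Y, y < M)
    (h : ∀ x < M, x ∈ X ↔ M - 1 - x ∉ Y) : (ofBetaSet X).transpose = ofBetaSet Y := by
  have h' : ∀ y < M, y ∈ Y ↔ M - 1 - y ∉ X := by
    intro y hy
    rw [h _ (by omega), not_not, show M - 1 - (M - 1 - y) = y by omega]
  -- Reflection matches the beads of `X` from `n` on with the gaps of `Y` below `M - n`.
  have key : ∀ {X Y : Finset ℕ}, (∀ x ∈ X, x < M) → (∀ x < M, x ∈ X ↔ M - 1 - x ∉ Y) →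
      ∀ n ≤ M, (X.filter fun x => n ≤ x).card =
        ((Finset.range (M - n)).filter fun y => y ∉ Y).card := by
    intro X Y hX h n hn
    refine Finset.card_bij' (fun x _ => M - 1 - x) (fun y _ => M - 1 - y) ?_ ?_ ?_ ?_
    · intro x hx
      rw [Finset.mem_filter] at hx
      have := hX x hx.1
      rw [Finset.mem_filter, Finset.mem_range]
      exact ⟨by omega, (h x this).1 hx.1⟩
    · intro y hy
      rw [Finset.mem_filter, Finset.mem_range] at hy
      rw [Finset.mem_filter, h _ (by omega), show M - 1 - (M - 1 - y) = y by omega]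
      exact ⟨hy.2, by omega⟩
    · intro x hx
      have := hX x (Finset.mem_filter.1 hx).1
      omega
    · intro y hy
      have := Finset.mem_range.1 (Finset.mem_filter.1 hy).1
      omega
  have imp : ∀ {X Y : Finset ℕ}, (∀ x ∈ X, x < M) → (∀ y ∈ Y, y < M) →
      (∀ x < M, x ∈ X ↔ M - 1 - x ∉ Y) → (∀ y < M, y ∈ Y ↔ M - 1 - y ∉ X) →
      ∀ {i j : ℕ}, (i, j) ∈ ofBetaSet X → (j, i) ∈ ofBetaSet Y := by
    intro X Y hX hY h h' i j hij
    obtain ⟨n, hi, hj⟩ := mem_ofBetaSet_iff_exists.1 hij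
    have hn : n ≤ M := by
      obtain ⟨x, hx⟩ := Finset.card_pos.1 (Nat.zero_lt_of_lt hi)
      rw [Finset.mem_filter] at hx
      have := hX x hx.1
      omega
    refine mem_ofBetaSet_iff_exists.2 ⟨M - n, ?_, ?_⟩
    · rw [key hY h' _ (Nat.sub_le _ _), Nat.sub_sub_self hn]
      exact hj
    · rw [← key hX h n hn]
      exact hi
  ext ⟨i, j⟩
  rw [YoungDiagram.mem_cells, YoungDiagram.mem_cells, YoungDiagram.mem_transpose]
  exact ⟨imp hX hY h h', imp hY hX h' h⟩

/-! ### Wright's map and conjugation -/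

theorem mem_wright {A : TwoRowedArray ℕ} {i j : ℕ} :
    (i, j) ∈ wright A ↔ (i < A.top.card ∧ j < A.bottom.card) ∨
      (i < A.top.card ∧ A.bottom.card ≤ j ∧ (i, j - A.bottom.card) ∈ ofBetaSet A.top) ∨
      (A.top.card ≤ i ∧ j < A.bottom.card ∧ (j, i - A.top.card) ∈ ofBetaSet A.bottom) := by
  have hν : (A.bottom.val.map fun b => b + position A.bottom b - A.bottom.card) =
      A.bottom.val.map fun x => ((Finset.range x).filter fun y => y ∉ A.bottom).card :=
    Multiset.map_congr rfl fun b _ => by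
      have := card_gaps_add_card A.bottom b
      omega
  have htop : (A.top.val.map fun a => a + position A.top a + A.bottom.card - A.top.card) =
      A.top.val.map fun x =>
        ((Finset.range x).filter fun y => y ∉ A.top).card + A.bottom.card :=
    Multiset.map_congr rfl fun a _ => by
      have := card_gaps_add_card A.top a
      omega
  have hw : wright A = ofParts ((A.top.val.map fun x =>
      ((Finset.range x).filter fun y => y ∉ A.top).card + A.bottom.card)
      + ((ofBetaSet A.bottom).transpose.rowLens : Multiset ℕ)) := by
    rw [← htop, ofBetaSet, ← hν]
    rfl
  rw [hw, mem_ofParts, Multiset.countP_add, countP_rowLens, YoungDiagram.colLen_transpose,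
    Multiset.countP_map]
  rcases lt_or_ge j A.bottom.card with hj | hj
  · have e : (A.top.val.filter fun x =>
        j < ((Finset.range x).filter fun y => y ∉ A.top).card + A.bottom.card) = A.top.val :=
      Multiset.filter_eq_self.2 fun _ _ => by omega
    rw [e, ← Finset.card]
    simp only [YoungDiagram.mem_iff_lt_rowLen]
    omega
  · have hz : (ofBetaSet A.bottom).rowLen j = 0 := by
      by_contra h0
      have := lt_card_of_mem_ofBetaSet
        (YoungDiagram.mem_iff_lt_rowLen.2 (Nat.pos_of_ne_zero h0))
      omega
    have e : (A.top.val.filter fun x =>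
        j < ((Finset.range x).filter fun y => y ∉ A.top).card + A.bottom.card) =
        (A.top.filter fun x => j - A.bottom.card <
          ((Finset.range x).filter fun y => y ∉ A.top).card).val := by
      rw [Finset.filter_val]
      exact Multiset.filter_congr fun _ _ => by omega
    rw [hz, e, ← Finset.card, add_zero, ← mem_ofBetaSet]
    constructor
    · intro h
      exact Or.inr (Or.inl ⟨lt_card_of_mem_ofBetaSet h, hj, h⟩)
    · rintro (h | h | h)
      · omega
      · exact h.2.2
      · omega

theorem transpose_wright (A : TwoRowedArray ℕ) :
    (wright A).transpose = wright ⟨A.bottom, A.top⟩ := by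
  ext ⟨i, j⟩
  rw [YoungDiagram.mem_cells, YoungDiagram.mem_cells, YoungDiagram.mem_transpose, Prod.swap_prod_mk,
    mem_wright, mem_wright]
  tauto

theorem ofFrobenius_eq_wright {A : TwoRowedArray ℕ} (h : A.top.card = A.bottom.card) :
    ofFrobenius A = wright A := by
  simp only [ofFrobenius, wright, ← h, Nat.add_sub_cancel]

theorem transpose_ofFrobenius_of_top_eq_bottom {A : TwoRowedArray ℕ} (h : A.top = A.bottom) :
    (ofFrobenius A).transpose = ofFrobenius A := by
  rw [ofFrobenius_eq_wright (by rw [h]), transpose_wright]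
  cases A
  cases h
  rfl

/-! ### The Frobenius form -/

theorem rowLen_eq_colLen {μ : YoungDiagram} (hμ : μ.transpose = μ) (i : ℕ) :
    μ.rowLen i = μ.colLen i := by
  rw [← μ.rowLen_transpose, hμ]

theorem frobenius_top_eq_bottom {μ : YoungDiagram} (h : μ.transpose = μ) :
    (frobenius μ).top = (frobenius μ).bottom := by
  simp only [frobenius, rowLen_eq_colLen h]

/-- With equal rows, each entry `a` occurs twice: with color `a % t` on top and `t - a % t - 1`
below, with the same quotient. -/
theorem colorClass_top_reflect {t : ℕ} (ht : 0 < t) {μ : YoungDiagram} (hμ : μ.transpose = μ)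
    {j : ℕ} (hj : j < t) : (colorClass t μ (t - j - 1)).top = (colorClass t μ j).bottom := by
  ext q
  simp only [colorClass, coloredFrobenius, ← frobenius_top_eq_bottom hμ, Finset.mem_image,
    Finset.mem_filter]
  constructor <;> rintro ⟨_, ⟨⟨a, ha, rfl⟩, hc⟩, rfl⟩ <;>
    refine ⟨_, ⟨⟨a, ha, rfl⟩, ?_⟩, rfl⟩ <;> have := Nat.mod_lt a ht <;> dsimp only at hc ⊢ <;> omega

theorem colorClass_bottom_reflect {t : ℕ} (ht : 0 < t) {μ : YoungDiagram} (hμ : μ.transpose = μ)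
    {j : ℕ} (hj : j < t) : (colorClass t μ (t - j - 1)).bottom = (colorClass t μ j).top := by
  rw [← colorClass_top_reflect ht hμ (by omega), show t - (t - j - 1) - 1 = j by omega]

theorem transpose_quotient {t : ℕ} (ht : 0 < t) {μ : YoungDiagram} (hμ : μ.transpose = μ)
    {j : ℕ} (hj : j < t) : (quotient t μ j).transpose = quotient t μ (t - j - 1) := by
  rw [quotient, quotient, transpose_wright, ← colorClass_top_reflect ht hμ hj,
    ← colorClass_bottom_reflect ht hμ hj]

theorem transpose_core {t : ℕ} (ht : 0 < t) {μ : YoungDiagram} (hμ : μ.transpose = μ) :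
    (core t μ).transpose = core t μ := by
  refine transpose_ofFrobenius_of_top_eq_bottom ?_
  ext x
  simp only [uncolor, coreColored, Finset.mem_image, Finset.mem_biUnion, Finset.mem_range]
  constructor
  · rintro ⟨_, ⟨j, hj, k, hk, rfl⟩, rfl⟩
    refine ⟨_, ⟨t - j - 1, by omega, k, ?_, rfl⟩, ?_⟩
    · rwa [colorClass_top_reflect ht hμ hj, colorClass_bottom_reflect ht hμ hj]
    · dsimp only
      omega
  · rintro ⟨_, ⟨j, hj, k, hk, rfl⟩, rfl⟩
    refine ⟨_, ⟨t - j - 1, by omega, k, ?_, rfl⟩, rfl⟩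
    rwa [colorClass_top_reflect ht hμ hj, colorClass_bottom_reflect ht hμ hj]

/-! ### The beta-set of a self-conjugate partition -/

theorem card_betaSet (μ : YoungDiagram) (N : ℕ) : (betaSet μ N).card = N := by
  rw [betaSet, Finset.card_image_of_injOn, Finset.card_range]
  intro i hi k hk h
  simp only [Finset.coe_range, Set.mem_Iio] at hi hk h
  rcases lt_trichotomy i k with hik | hik | hik
  · have := μ.rowLen_anti i k hik.le
    omega
  · exact hik
  · have := μ.rowLen_anti k i hik.le
    omega

theorem lt_of_mem_betaSet {μ : YoungDiagram} (hμ : μ.transpose = μ) {N : ℕ}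
    (hN : μ.colLen 0 ≤ N) {x : ℕ} (hx : x ∈ betaSet μ N) : x < 2 * N := by
  simp only [betaSet, Finset.mem_image, Finset.mem_range] at hx
  obtain ⟨i, hi, rfl⟩ := hx
  have := μ.rowLen_anti 0 i (Nat.zero_le i)
  -- Self-conjugacy turns the bound on the number of parts into one on the largest part.
  rw [rowLen_eq_colLen hμ 0] at this
  omega

/-- The beta-set with `N` beads of a self-conjugate partition is the reflection of its complement
in `{0, …, 2 N - 1}`. -/
theorem mem_betaSet_iff_reflect {μ : YoungDiagram} (hμ : μ.transpose = μ) {N : ℕ}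
    (hN : μ.colLen 0 ≤ N) {x : ℕ} (hx : x < 2 * N) :
    x ∈ betaSet μ N ↔ 2 * N - 1 - x ∉ betaSet μ N := by
  set X := betaSet μ N with hX
  have hlt : ∀ x ∈ X, x < 2 * N := fun x hx => lt_of_mem_betaSet hμ hN hx
  have hdisj : ∀ x ∈ X, 2 * N - 1 - x ∉ X := by
    intro x hx hx'
    have hx2 := hlt x hx
    simp only [hX, betaSet, Finset.mem_image, Finset.mem_range] at hx hx'
    obtain ⟨i, hi, rfl⟩ := hx
    obtain ⟨k, hk, hik⟩ := hx'
    -- Two beads summing to 2N - 1 would force `μ.rowLen i + μ.rowLen k = i + k + 1`. By symmetry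
    -- the boxes (i, k) and (k, i) are both present, giving a sum of at least i + k + 2, or both
    -- absent, giving at most i + k.
    have h : k < μ.rowLen i ↔ i < μ.rowLen k := by
      rw [← YoungDiagram.mem_iff_lt_rowLen, YoungDiagram.mem_iff_lt_colLen, rowLen_eq_colLen hμ k]
    omega
  refine ⟨hdisj x, fun hx' => ?_⟩
  have hcard : (X.image fun x => 2 * N - 1 - x).card = N := by
    rw [Finset.card_image_of_injOn, card_betaSet]
    intro a ha b hb hab
    have := hlt a ha
    have := hlt b hb
    dsimp only at hab
    omega
  -- Two disjoint sets of N elements fill the window of size 2N.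
  have hunion : X ∪ X.image (fun x => 2 * N - 1 - x) = Finset.range (2 * N) := by
    refine Finset.eq_of_subset_of_card_le ?_ ?_
    · intro y hy
      rw [Finset.mem_range]
      rcases Finset.mem_union.1 hy with hy | hy
      · exact hlt y hy
      · obtain ⟨z, hz, rfl⟩ := Finset.mem_image.1 hy
        have := hlt z hz
        omega
    · rw [Finset.card_union_of_disjoint, hcard, hX, card_betaSet, Finset.card_range]
      · omega
      · rw [Finset.disjoint_right]
        intro y hy hy'
        obtain ⟨z, hz, rfl⟩ := Finset.mem_image.1 hy
        exact hdisj z hz hy'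
  have hmem := Finset.mem_range.2 hx
  rw [← hunion, Finset.mem_union] at hmem
  rcases hmem with h | h
  · exact h
  · obtain ⟨z, hz, rfl⟩ := Finset.mem_image.1 h
    have := hlt z hz
    rw [show 2 * N - 1 - (2 * N - 1 - z) = z by omega] at hx'
    exact absurd hz hx'

/-! ### Runners under reflection -/

theorem mem_runner {t : ℕ} {X : Finset ℕ} {j q : ℕ} (hj : j < t) :
    q ∈ runner t X j ↔ t * q + j ∈ X := by
  simp only [runner, Finset.mem_image, Finset.mem_filter]
  constructor
  · rintro ⟨x, ⟨hx, rfl⟩, rfl⟩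
    rwa [Nat.div_add_mod]
  · intro h
    refine ⟨_, ⟨h, ?_⟩, ?_⟩
    · rw [Nat.mul_add_mod, Nat.mod_eq_of_lt hj]
    · rw [Nat.mul_add_div (Nat.zero_lt_of_lt hj), Nat.div_eq_of_lt hj, add_zero]

theorem lt_of_mul_add_lt_mul {t q j K : ℕ} (h : t * q + j < t * K) : q < K :=
  lt_of_mul_lt_mul_left (lt_of_le_of_lt (Nat.le_add_right _ _) h) (Nat.zero_le t)

theorem mul_add_lt_mul {t q j K : ℕ} (hj : j < t) (hq : q < K) : t * q + j < t * K := by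
  have := Nat.mul_le_mul_left t (Nat.succ_le_of_lt hq)
  rw [Nat.mul_succ] at this
  omega

/-- A window of `K` complete rows of the abacus is reversed both across the runners and along each
of them. -/
theorem reflect_mul_add {t q j K : ℕ} (hj : j < t) (hq : q < K) :
    t * K - 1 - (t * q + j) = t * (K - 1 - q) + (t - j - 1) := by
  obtain ⟨d, rfl⟩ := Nat.exists_eq_add_of_lt hq
  rw [show q + d + 1 - 1 - q = d by omega, Nat.mul_add, Nat.mul_add, Nat.mul_one]
  omega

section Runner

variable {t : ℕ} {X : Finset ℕ} {K : ℕ}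

theorem lt_of_mem_runner (hX : ∀ x ∈ X, x < t * K) {j q : ℕ} (hj : j < t)
    (hq : q ∈ runner t X j) : q < K :=
  lt_of_mul_add_lt_mul (hX _ ((mem_runner hj).1 hq))

theorem mem_runner_iff_reflect (h : ∀ x < t * K, x ∈ X ↔ t * K - 1 - x ∉ X) {j q : ℕ}
    (hj : j < t) (hq : q < K) : q ∈ runner t X j ↔ K - 1 - q ∉ runner t X (t - j - 1) := by
  rw [mem_runner hj, mem_runner (by omega), h _ (mul_add_lt_mul hj hq), reflect_mul_add hj hq]

theorem card_runner_add_card_runner_reflect (hX : ∀ x ∈ X, x < t * K)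
    (h : ∀ x < t * K, x ∈ X ↔ t * K - 1 - x ∉ X) {j : ℕ} (hj : j < t) :
    (runner t X j).card + (runner t X (t - j - 1)).card = K := by
  have hj' : t - j - 1 < t := by omega
  have e : (runner t X (t - j - 1)).card = (Finset.range K \ runner t X j).card := by
    refine Finset.card_bij' (fun q _ => K - 1 - q) (fun q _ => K - 1 - q) ?_ ?_ ?_ ?_
    · intro q hq
      have hqK := lt_of_mem_runner hX hj' hq
      rw [Finset.mem_sdiff, Finset.mem_range]
      refine ⟨by omega, ?_⟩
      rw [mem_runner_iff_reflect h hj' hqK, show t - (t - j - 1) - 1 = j by omega] at hq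
      exact hq
    · intro q hq
      rw [Finset.mem_sdiff, Finset.mem_range] at hq
      exact not_not.1 (mt (mem_runner_iff_reflect h hj hq.1).2 hq.2)
    · intro q hq
      have hqK := lt_of_mem_runner hX hj' hq
      omega
    · intro q hq
      have := Finset.mem_range.1 (Finset.mem_sdiff.1 hq).1
      omega
  rw [e, add_comm, Finset.card_sdiff_add_card_eq_card, Finset.card_range]
  intro q hq
  exact Finset.mem_range.2 (lt_of_mem_runner hX hj hq)

theorem mem_pushed_iff {c : ℕ → ℕ} {j q : ℕ} (hj : j < t) :
    t * q + j ∈ ((Finset.range t).biUnion fun j =>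
      (Finset.range (c j)).image fun q => t * q + j) ↔ q < c j := by
  simp only [Finset.mem_biUnion, Finset.mem_image, Finset.mem_range]
  constructor
  · rintro ⟨i, hi, p, hp, e⟩
    have hm := congrArg (· % t) e
    simp only [Nat.mul_add_mod, Nat.mod_eq_of_lt hi, Nat.mod_eq_of_lt hj] at hm
    subst hm
    rwa [← Nat.eq_of_mul_eq_mul_left (Nat.zero_lt_of_lt hj) (Nat.add_right_cancel e)]
  · intro h
    exact ⟨j, hj, q, h, rfl⟩

end Runner

/-! ### The abacus form -/

theorem transpose_abacusQuotient {t N : ℕ} {μ : YoungDiagram} (hμ : μ.transpose = μ)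
    (htN : t ∣ N) (hN : μ.colLen 0 ≤ N) {j : ℕ} (hj : j < t) :
    (abacusQuotient t N μ j).transpose = abacusQuotient t N μ (t - j - 1) := by
  obtain ⟨L, rfl⟩ := htN
  have e : 2 * (t * L) = t * (2 * L) := by ring
  have hlt : ∀ x ∈ betaSet μ (t * L), x < t * (2 * L) := fun x hx =>
    e ▸ lt_of_mem_betaSet hμ hN hx
  have hrefl : ∀ x < t * (2 * L), x ∈ betaSet μ (t * L) ↔
      t * (2 * L) - 1 - x ∉ betaSet μ (t * L) := by
    rw [← e]
    exact fun x hx => mem_betaSet_iff_reflect hμ hN hx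
  exact transpose_ofBetaSet (fun q hq => lt_of_mem_runner hlt hj hq)
    (fun q hq => lt_of_mem_runner hlt (by omega) hq)
    (fun q hq => mem_runner_iff_reflect hrefl hj hq)

theorem transpose_abacusCore {t N : ℕ} (ht : 0 < t) {μ : YoungDiagram} (hμ : μ.transpose = μ)
    (htN : t ∣ N) (hN : μ.colLen 0 ≤ N) :
    (abacusCore t N μ).transpose = abacusCore t N μ := by
  obtain ⟨L, rfl⟩ := htN
  have e : 2 * (t * L) = t * (2 * L) := by ring
  have hlt : ∀ x ∈ betaSet μ (t * L), x < t * (2 * L) := fun x hx =>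
    e ▸ lt_of_mem_betaSet hμ hN hx
  have hrefl : ∀ x < t * (2 * L), x ∈ betaSet μ (t * L) ↔
      t * (2 * L) - 1 - x ∉ betaSet μ (t * L) := by
    rw [← e]
    exact fun x hx => mem_betaSet_iff_reflect hμ hN hx
  have hcard : ∀ j < t, _ := fun j hj => card_runner_add_card_runner_reflect hlt hrefl hj
  have hbound : ∀ x ∈ ((Finset.range t).biUnion fun j =>
      (Finset.range (runner t (betaSet μ (t * L)) j).card).image fun q => t * q + j),
      x < t * (2 * L) := by
    intro x hx
    have hxt := Nat.mod_lt x ht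
    rw [← Nat.div_add_mod x t] at hx ⊢
    rw [mem_pushed_iff (c := fun j => (runner t (betaSet μ (t * L)) j).card) hxt] at hx
    have := hcard _ hxt
    exact mul_add_lt_mul hxt (by omega)
  refine transpose_ofBetaSet hbound hbound fun x hx => ?_
  have hxt := Nat.mod_lt x ht
  rw [← Nat.div_add_mod x t] at hx ⊢
  have hq := lt_of_mul_add_lt_mul hx
  have := hcard _ hxt
  -- With c + c' = 2L for the bead counts of opposite runners, q < c is equivalent to 2L - 1 - q ≥
  -- c'.
  rw [reflect_mul_add hxt hq,
    mem_pushed_iff (c := fun j => (runner t (betaSet μ (t * L)) j).card) hxt,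
    mem_pushed_iff (c := fun j => (runner t (betaSet μ (t * L)) j).card) (by omega)]
  omega

end Littlewood

theorem mainTheorem4 (t : ℕ) (ht : 0 < t) (lam : YoungDiagram) (hlam : lam.transpose = lam) :
    ((Littlewood.core t lam).transpose = Littlewood.core t lam ∧
      ∀ j : ℕ, j < t →
        (Littlewood.quotient t lam j).transpose = Littlewood.quotient t lam (t - j - 1)) ∧
    ∀ N : ℕ, t ∣ N → lam.colLen 0 ≤ N →
      ((Littlewood.abacusCore t N lam).transpose = Littlewood.abacusCore t N lam ∧
        ∀ j : ℕ, j < t →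
          (Littlewood.abacusQuotient t N lam j).transpose =
            Littlewood.abacusQuotient t N lam (t - j - 1)) :=
  ⟨⟨Littlewood.transpose_core ht hlam, fun _ hj => Littlewood.transpose_quotient ht hlam hj⟩,
    fun _ htN hN => ⟨Littlewood.transpose_abacusCore ht hlam htN hN,
      fun _ hj => Littlewood.transpose_abacusQuotient hlam htN hN hj⟩⟩
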